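/- Let $p$ be a prime, let $m<n$ be non-negative integers, and let $L:\mathbb F_p^n\to\mathbb F_p^m$ be a linear map of rank $m$. For $v\in\mathbb F_p^n$ let $\operatorname{supp}(v)=\{i\in[n] : v_i\neq 0\}$, where $[n]=\{1,\dots,n\}$, and let $$\operatorname{supker}(L)=\{\operatorname{supp}(v) : v\in\ker L,\ v\neq 0\}.$$ Let $S$ be an inclusion-minimal element of $\operatorname{supker}(L)$, and let $S'$ be an inclusion-maximal subset of $[n]\setminus S$ such that $S$ is the only element of $\operatorname{supker}(L)$ contained in $S\cup S'$. Let $k_1,\dots,k_n$ be integers with $1\le k_i\le p$ for all $i$, put $k_{\max}=\max_{i\in S}k_i$ and $k_{\min}=\min_{i\in S}k_i$, and suppose that $p\ge k_{\max}+k_{\min}-1$. Then for all sets $A_1,\dots,A_n\subseteq\mathbb F_p$ with $|A_i|=k_i$ for every $i$, the set $L(A_1,\dots,A_n)=\{L(a_1,\dots,a_n) : a_i\in A_i \text{ for each } i\}$ satisfies $$|L(A_1,\dots,A_n)|\ \ge\ \Bigl(\prod_{i\in S}k_i-\prod_{i\in S}(k_i-1)\Bigr)\prod_{i\in S'}k_i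 .$$ -/

import Mathlib

/-- The support of a vector `v ∈ 𝔽_p^n`: the set of coordinates where it is nonzero. -/
def vecSupp {p n : ℕ} (v : Fin n → ZMod p) : Finset (Fin n) :=
  Finset.univ.filter fun i => v i ≠ 0

/-- The support-kernel of `L`: all supports of nonzero vectors of `ker L`. -/
def supker {p n m : ℕ} (L : (Fin n → ZMod p) →ₗ[ZMod p] (Fin m → ZMod p)) :
    Set (Finset (Fin n)) :=
  {S | ∃ v ∈ LinearMap.ker L, v ≠ 0 ∧ vecSupp v = S}

/-- `L(A₁, …, Aₙ)`, the image under `L` of the product set `A₁ × ⋯ × Aₙ`. -/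
def prodImage {p n m : ℕ} (L : (Fin n → ZMod p) →ₗ[ZMod p] (Fin m → ZMod p))
    (A : Fin n → Finset (ZMod p)) : Finset (Fin m → ZMod p) :=
  (Fintype.piFinset A).image L

open scoped Pointwise

/-! Freeze the coordinates outside `S ∪ S'`. On the rest, `ker L` is the line through the circuit
vector `v`, so `L` separates points up to multiples of `v`. After dividing by the `v i`, this counts
the `S`-box modulo the diagonal, times the full `S'`-box. Subtracting the coordinate at some `j ∈ S`
picks one representative per class, which gives `diagDiff` over `S.erase j`. Its size is bounded one
coordinate at a time by Cauchy-Davenport. -/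

/-- The differences, supported on `T`, of points of the box `∏ i ∈ T, B i` and diagonal points
with entry in `A`. -/
def diagDiff {p n : ℕ} [NeZero p] (A : Finset (ZMod p)) (B : Fin n → Finset (ZMod p))
    (T : Finset (Fin n)) : Finset (Fin n → ZMod p) :=
  Finset.univ.filter fun g => ∃ a ∈ A, ∀ i, if i ∈ T then g i + a ∈ B i else g i = 0

/-- The translates of the box through `g` with parameter in `A`. -/
def diagFiber {p n : ℕ} (A : Finset (ZMod p)) (B : Fin n → Finset (ZMod p))
    (T : Finset (Fin n)) (g : Fin n → ZMod p) : Finset (ZMod p) :=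
  A.filter fun a => ∀ i, if i ∈ T then g i + a ∈ B i else g i = 0

theorem mem_diagDiff_iff_nonempty {p n : ℕ} [NeZero p] {A : Finset (ZMod p)}
    {B : Fin n → Finset (ZMod p)} {T : Finset (Fin n)} {g : Fin n → ZMod p} :
    g ∈ diagDiff A B T ↔ (diagFiber A B T g).Nonempty := by
  simp [diagDiff, diagFiber, Finset.Nonempty]

theorem card_translated_box {p n : ℕ} [NeZero p] (B : Fin n → Finset (ZMod p))
    (T : Finset (Fin n)) (a : ZMod p) :
    (Finset.univ.filter fun g : Fin n → ZMod p =>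
      ∀ i, if i ∈ T then g i + a ∈ B i else g i = 0).card = ∏ i ∈ T, (B i).card := by
  have h : (Finset.univ.filter fun g : Fin n → ZMod p =>
      ∀ i, if i ∈ T then g i + a ∈ B i else g i = 0) =
      Fintype.piFinset fun i => if i ∈ T then (B i).image (· - a) else {0} := by
    ext g
    simp only [Finset.mem_filter, Finset.mem_univ, true_and, Fintype.mem_piFinset]
    refine forall_congr' fun i => ?_
    split_ifs
    · simp [sub_eq_iff_eq_add]
    · simp
  rw [h, Fintype.card_piFinset, ← Finset.prod_subset (Finset.subset_univ T)]
  · refine Finset.prod_congr rfl fun i hi => ?_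
    rw [if_pos hi, Finset.card_image_of_injective _ (sub_left_injective)]
  · intro i _ hi
    simp [hi]

/-- Double counting of the pairs `(a, g)`: each `a ∈ A` contributes one translated box. -/
theorem sum_card_diagFiber {p n : ℕ} [NeZero p] (A : Finset (ZMod p))
    (B : Fin n → Finset (ZMod p)) (T : Finset (Fin n)) :
    ∑ g ∈ diagDiff A B T, (diagFiber A B T g).card = A.card * ∏ i ∈ T, (B i).card := by
  have h : ∑ g ∈ diagDiff A B T, (diagFiber A B T g).card
      = ∑ g, (diagFiber A B T g).card := by
    refine Finset.sum_subset (Finset.subset_univ _) fun g _ hg => ?_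
    rwa [mem_diagDiff_iff_nonempty, Finset.not_nonempty_iff_eq_empty,
      ← Finset.card_eq_zero] at hg
  rw [h]
  simp only [diagFiber, Finset.card_filter]
  rw [Finset.sum_comm]
  simp only [← Finset.card_filter, card_translated_box, Finset.sum_const, smul_eq_mul]

/-- Each point of `diagDiff A B T` extends to `insert i T` in as many ways as there are
differences between `B i` and its fiber, so Cauchy-Davenport applies. -/
theorem card_extensions_ge {p n : ℕ} [Fact p.Prime] {A : Finset (ZMod p)}
    {B : Fin n → Finset (ZMod p)} {T : Finset (Fin n)} {i : Fin n} (hi : i ∉ T)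
    (hB : (B i).Nonempty) (hp : (B i).card + A.card ≤ p + 1)
    {g : Fin n → ZMod p} (hg : g ∈ diagDiff A B T) :
    (B i).card + (diagFiber A B T g).card ≤
      ((diagDiff A B (insert i T)).filter fun f => Function.update f i 0 = g).card + 1 := by
  set R := diagFiber A B T g with hR
  have hRne : R.Nonempty := mem_diagDiff_iff_nonempty.1 hg
  have hRA : R.card ≤ A.card := Finset.card_le_card (Finset.filter_subset _ _)
  have hcd := ZMod.cauchy_davenport (Fact.out : p.Prime) hB hRne.neg
  rw [Finset.card_neg, min_eq_right (by omega)] at hcd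
  have hgi : g i = 0 := by
    obtain ⟨a, ha⟩ := hRne
    simpa [hi] using (Finset.mem_filter.1 ha).2 i
  have hle : (B i + -R).card ≤
      ((diagDiff A B (insert i T)).filter fun f => Function.update f i 0 = g).card := by
    refine Finset.card_le_card_of_injOn (fun x => Function.update g i x) ?_ ?_
    · intro x hx
      obtain ⟨b, hb, y, hy, rfl⟩ := Finset.mem_add.1 (Finset.mem_coe.1 hx)
      obtain ⟨haA, ha⟩ := Finset.mem_filter.1 (Finset.mem_neg'.1 hy)
      simp only [Finset.coe_filter, Set.mem_ofPred_eq, Function.update_idem]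
      refine ⟨Finset.mem_filter.2 ⟨Finset.mem_univ _, -y, haA, fun l => ?_⟩, ?_⟩
      · rcases eq_or_ne l i with rfl | hl
        · simpa using hb
        · simpa [Finset.mem_insert, hl] using ha l
      · rw [← hgi, Function.update_eq_self]
    · exact (Function.update_injective g i).injOn
  omega

/-- Summing `card_extensions_ge` over `g` gives `D(T ∪ {i}) ≥ (|B i| - 1) D(T) + |A| ∏_T |B l|`,
where `D` is the size of `diagDiff`; the bound solves this recursion with `D(∅) ≥ 1`. -/
theorem card_diagDiff_ge {p n : ℕ} [Fact p.Prime] {A : Finset (ZMod p)} (hA : A.Nonempty)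
    {B : Fin n → Finset (ZMod p)} (T : Finset (Fin n)) (hB : ∀ i ∈ T, (B i).Nonempty)
    (hp : ∀ i ∈ T, (B i).card + A.card ≤ p + 1) :
    (A.card : ℤ) * ∏ i ∈ T, ((B i).card : ℤ) - (A.card - 1) * ∏ i ∈ T, ((B i).card - 1 : ℤ)
      ≤ (diagDiff A B T).card := by
  induction T using Finset.induction_on with
  | empty =>
    have : 0 < (diagDiff A B ∅).card :=
      Finset.card_pos.2 ⟨0, mem_diagDiff_iff_nonempty.2 (by simpa [diagFiber] using hA)⟩
    simp only [Finset.prod_empty]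
    omega
  | insert i T hi ih =>
    have ih := ih (fun l hl => hB l (Finset.mem_insert_of_mem hl))
      (fun l hl => hp l (Finset.mem_insert_of_mem hl))
    have hBi := hB i (Finset.mem_insert_self i T)
    have hpi := hp i (Finset.mem_insert_self i T)
    have hmap : ∀ f ∈ diagDiff A B (insert i T), Function.update f i 0 ∈ diagDiff A B T := by
      intro f hf
      obtain ⟨a, ha, h⟩ := (Finset.mem_filter.1 hf).2
      refine Finset.mem_filter.2 ⟨Finset.mem_univ _, a, ha, fun l => ?_⟩
      rcases eq_or_ne l i with rfl | hl
      · simp [hi]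
      · simpa [Finset.mem_insert, hl] using h l
    have hsum : ∑ g ∈ diagDiff A B T, ((B i).card + (diagFiber A B T g).card : ℤ)
        ≤ (diagDiff A B (insert i T)).card + (diagDiff A B T).card := by
      rw [Finset.card_eq_sum_card_fiberwise hmap, Finset.card_eq_sum_ones (diagDiff A B T)]
      push_cast
      rw [← Finset.sum_add_distrib]
      exact Finset.sum_le_sum fun g hg => by exact_mod_cast card_extensions_ge hi hBi hpi hg
    have hfib := congrArg (Nat.cast : ℕ → ℤ) (sum_card_diagFiber A B T)
    push_cast at hfib
    rw [Finset.sum_add_distrib, hfib, Finset.sum_const, nsmul_eq_mul] at hsum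
    rw [Finset.prod_insert hi, Finset.prod_insert hi]
    have hpos : (0 : ℤ) ≤ (B i).card - 1 := by
      have := hBi.card_pos
      omega
    have := mul_le_mul_of_nonneg_left ih hpos
    linarith

/-- A circuit `S = vecSupp v` which is the only one inside `S' ∪ S` spans all kernel vectors
supported on `S' ∪ S`. -/
theorem eq_smul_of_mem_ker {p n m : ℕ} [Fact p.Prime]
    {L : (Fin n → ZMod p) →ₗ[ZMod p] (Fin m → ZMod p)} {S S' : Finset (Fin n)}
    (hS : {U : Finset (Fin n) | U ⊆ S' ∪ S} ∩ supker L ⊆ {S})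
    {v : Fin n → ZMod p} (hv : L v = 0) (hvS : vecSupp v = S) {j : Fin n} (hj : j ∈ S)
    {y : Fin n → ZMod p} (hy : L y = 0) (hyS : ∀ i, i ∉ S' ∪ S → y i = 0) :
    y = (y j / v j) • v := by
  have hv0 : ∀ i, v i ≠ 0 ↔ i ∈ S := fun i => by simp [← hvS, vecSupp]
  by_contra hne
  -- Cancelling coordinate `j ∈ S` leaves a kernel vector inside `S' ∪ S` whose support cannot be
  -- `S`.
  set z := y - (y j / v j) • v with hz
  have hzj : z j = 0 := by
    simp [hz, div_mul_cancel₀ _ ((hv0 j).2 hj)]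
  have hmem : vecSupp z = S := by
    refine hS ⟨fun i hi => ?_, z, ?_, sub_ne_zero.2 hne, rfl⟩
    · by_contra hi'
      refine (Finset.mem_filter.1 hi).2 ?_
      have : v i = 0 := by
        by_contra h
        exact hi' (Finset.mem_union_right _ ((hv0 i).1 h))
      simp [hz, hyS i hi', this]
    · simp [hz, LinearMap.mem_ker, hy, hv]
  rw [← hmem] at hj
  exact (Finset.mem_filter.1 hj).2 hzj

theorem card_diagDiff_mul_le_card_prodImage {p n m : ℕ} [Fact p.Prime]
    {L : (Fin n → ZMod p) →ₗ[ZMod p] (Fin m → ZMod p)} {S S' : Finset (Fin n)}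
    (hS : {U : Finset (Fin n) | U ⊆ S' ∪ S} ∩ supker L ⊆ {S}) (hdisj : S' ⊆ Sᶜ)
    {v : Fin n → ZMod p} (hv : L v = 0) (hvS : vecSupp v = S) {j : Fin n} (hj : j ∈ S)
    (A : Fin n → Finset (ZMod p)) (hA : ∀ i, (A i).Nonempty) :
    (diagDiff ((A j).image (· / v j)) (fun i => (A i).image (· / v i)) (S.erase j)).card
        * ∏ i ∈ S', (A i).card ≤ (prodImage L A).card := by
  have hv0 : ∀ i ∈ S, v i ≠ 0 := fun i hi => by
    rw [← hvS] at hi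
    exact (Finset.mem_filter.1 hi).2
  choose b hb using hA
  set H := Fintype.piFinset fun i => if i ∈ S' then A i else {b i} with hH
  have hHcard : H.card = ∏ i ∈ S', (A i).card := by
    rw [hH, Fintype.card_piFinset, ← Finset.prod_subset (Finset.subset_univ S')]
    · exact Finset.prod_congr rfl fun i hi => by rw [if_pos hi]
    · intro i _ hi
      simp [hi]
  set D := diagDiff ((A j).image (· / v j)) (fun i => (A i).image (· / v i)) (S.erase j) with hD
  have hlift : ∀ g ∈ D, ∃ a, g j = 0 ∧ (∀ i ∈ S, v i * (g i + a) ∈ A i) ∧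
      ∀ i ∉ S, g i = 0 := by
    intro g hg
    obtain ⟨a, ha, h⟩ := (Finset.mem_filter.1 hg).2
    have hgj : g j = 0 := by simpa using h j
    refine ⟨a, hgj, fun i hi => ?_, fun i hi => by simpa [hi] using h i⟩
    have : g i + a ∈ (A i).image (· / v i) := by
      rcases eq_or_ne i j with rfl | hij
      · simpa [hgj] using ha
      · simpa [hij, hi] using h i
    obtain ⟨x, hx, hxe⟩ := Finset.mem_image.1 this
    rw [← hxe, mul_div_cancel₀ _ (hv0 i hi)]
    exact hx
  choose! t ht using hlift
  -- One box point per pair: `t` picks a diagonal shift for `g`, and undoing the scaling by `v`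
  -- lands in the `A i`.
  let pt : (Fin n → ZMod p) × (Fin n → ZMod p) → Fin n → ZMod p :=
    fun q i => if i ∈ S then v i * (q.1 i + t q.1) else q.2 i
  rw [← hHcard, ← Finset.card_product]
  refine Finset.card_le_card_of_injOn (fun q => L (pt q)) ?_ ?_
  · rintro ⟨g, h⟩ hq
    obtain ⟨hg, hh⟩ := Finset.mem_product.1 (Finset.mem_coe.1 hq)
    refine Finset.mem_coe.2 (Finset.mem_image_of_mem _ (Fintype.mem_piFinset.2 fun i => ?_))
    by_cases hi : i ∈ S
    · simpa [pt, hi] using (ht g hg).2.1 i hi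
    · have := Fintype.mem_piFinset.1 hh i
      by_cases hi' : i ∈ S'
      · simpa [pt, hi, hi'] using this
      · have : h i = b i := by simpa [hi'] using this
        simpa [pt, hi, this] using hb i
  · rintro ⟨g, h⟩ hq ⟨g', h'⟩ hq' heq
    obtain ⟨hg, hh⟩ := Finset.mem_product.1 (Finset.mem_coe.1 hq)
    obtain ⟨hg', hh'⟩ := Finset.mem_product.1 (Finset.mem_coe.1 hq')
    have hh_out : ∀ i ∉ S', h i = h' i := fun i hi => by
      have h1 := Fintype.mem_piFinset.1 hh i
      have h2 := Fintype.mem_piFinset.1 hh' i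
      simp only [hi, if_false, Finset.mem_singleton] at h1 h2
      rw [h1, h2]
    have hy := eq_smul_of_mem_ker hS hv hvS hj (y := pt (g, h) - pt (g', h'))
      (by rw [map_sub]; exact sub_eq_zero.2 heq)
      (fun i hi => by
        rw [Finset.mem_union, not_or] at hi
        simp [pt, hi.2, hh_out i hi.1])
    -- Both representatives vanish at `j`, so only the shifts remain; the multiple of `v` then
    -- cancels them on `S`.
    have hc : (pt (g, h) - pt (g', h')) j / v j = t g - t g' := by
      rw [div_eq_iff (hv0 j hj)]
      simp only [Pi.sub_apply, pt, if_pos hj, (ht g hg).1, (ht g' hg').1]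
      ring
    rw [hc] at hy
    refine Prod.ext (funext fun i => ?_) (funext fun i => ?_)
    · by_cases hi : i ∈ S
      · have h1 := congrFun hy i
        simp only [Pi.sub_apply, pt, if_pos hi, Pi.smul_apply, smul_eq_mul] at h1
        refine mul_left_cancel₀ (hv0 i hi) ?_
        linear_combination h1
      · exact ((ht g hg).2.2 i hi).trans ((ht g' hg').2.2 i hi).symm
    · by_cases hi' : i ∈ S'
      · have hi : i ∉ S := Finset.mem_compl.1 (hdisj hi')
        have h1 := congrFun hy i
        have hvi : v i = 0 := by
          by_contra hne
          exact hi (hvS ▸ Finset.mem_filter.2 ⟨Finset.mem_univ _, hne⟩)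
        simpa [pt, hi, hvi, sub_eq_zero] using h1
      · exact hh_out i hi'

theorem theorem2 (p : ℕ) (hp : p.Prime) (n m : ℕ) (hmn : m < n)
    (L : (Fin n → ZMod p) →ₗ[ZMod p] (Fin m → ZMod p))
    (hL : Module.finrank (ZMod p) (LinearMap.range L) = m)
    (S : Finset (Fin n)) (hS : Minimal (fun T => T ∈ supker L) S)
    (S' : Finset (Fin n))
    (hS' : Maximal (fun T : Finset (Fin n) =>
      T ⊆ Sᶜ ∧ {U : Finset (Fin n) | U ⊆ T ∪ S} ∩ supker L = {S}) S')
    (k : Fin n → ℕ) (hk : ∀ i, 1 ≤ k i ∧ k i ≤ p)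
    (kmax kmin : ℕ) (hmax : IsGreatest (k '' (S : Set (Fin n))) kmax)
    (hmin : IsLeast (k '' (S : Set (Fin n))) kmin)
    (hpk : (kmax : ℤ) + (kmin : ℤ) - 1 ≤ (p : ℤ))
    (A : Fin n → Finset (ZMod p)) (hA : ∀ i, (A i).card = k i) :
    ((∏ i ∈ S, (k i : ℤ)) - ∏ i ∈ S, ((k i : ℤ) - 1)) * ∏ i ∈ S', (k i : ℤ)
      ≤ ((prodImage L A).card : ℤ) := by
  have : Fact p.Prime := ⟨hp⟩
  obtain ⟨v, hv, -, hvS⟩ := hS.prop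
  -- With `k j = kmin`, the hypothesis on `p` gives `k i + k j ≤ p + 1` for every `i ∈ S`, as
  -- Cauchy-Davenport needs.
  obtain ⟨j, hj, hjmin⟩ := hmin.1
  have hj : j ∈ S := hj
  have hne : ∀ i, (A i).Nonempty := fun i =>
    Finset.card_pos.1 ((hA i).symm ▸ (hk i).1)
  have hcard : ∀ i ∈ S, ((A i).image (· / v i)).card = k i := fun i hi => by
    rw [← hvS] at hi
    rw [← hA i, Finset.card_image_of_injective _ fun x y h =>
      (div_left_inj' (Finset.mem_filter.1 hi).2).1 h]
  have hbox := card_diagDiff_mul_le_card_prodImage hS'.prop.2.subset hS'.prop.1 hv hvS hj A hne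
  have hdiff := card_diagDiff_ge ((hne j).image (· / v j))
    (B := fun i => (A i).image (· / v i)) (S.erase j) (fun i _ => (hne i).image _)
    (fun i hi => by
      have hi := Finset.mem_of_mem_erase hi
      have hle : k i ≤ kmax := hmax.2 ⟨i, hi, rfl⟩
      rw [hcard i hi, hcard j hj]
      omega)
  have hprod : ∀ f : ℤ → ℤ, ∏ i ∈ S.erase j, f (((A i).image (· / v i)).card : ℤ) =
      ∏ i ∈ S.erase j, f (k i) := fun f =>
    Finset.prod_congr rfl fun i hi => by rw [hcard i (Finset.mem_of_mem_erase hi)]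
  rw [hprod fun x => x, hprod fun x => x - 1, hcard j hj,
    Finset.mul_prod_erase S (fun i => (k i : ℤ)) hj,
    Finset.mul_prod_erase S (fun i => (k i : ℤ) - 1) hj] at hdiff
  simp only [hA] at hbox
  calc _ ≤ _ := mul_le_mul_of_nonneg_right hdiff (Finset.prod_nonneg fun i _ => by positivity)
    _ ≤ _ := by exact_mod_cast hbox
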